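/- Let $\mathfrak M$ be a complex Hilbert space with inner product $(\cdot,\cdot)$ linear in the first argument, and let $\mathbb R_+=[0,\infty)$. A linear relation in $\mathfrak M$ is a linear subspace $T$ of $\mathfrak M\times\mathfrak M$; operators are identified with their graphs, and $T^{-1}=\{\{f',f\}:\{f,f'\}\in T\}$, $cT=\{\{f,cf'\}:\{f,f'\}\in T\}$, $T+c=\{\{f,f'+cf\}:\{f,f'\}\in T\}$, $T^*=\{\{k,k'\}:(h',k)=(h,k')\text{ for all }\{h,h'\}\in T\}$. The relation $T$ is dissipative (accumulative) if $\operatorname{Im}(f',f)\ge 0$ ($\le 0$) for all $\{f,f'\}\in T$, maximal dissipative (maximal accumulative) if it has no proper extension with this property, and $T\ge 0$ ($T\le 0$) if $(f',f)$ is real and $\ge 0$ ($\le 0$) for all $\{f,f'\}\in T$. A Nevanlinna family is a family of linear relations $\mathcal M(\lambda)$, $\lambda\in\mathbb C\setminus\mathbb R$, in $\mathfrak M$ such that $\mathcal M(\lambda)$ is maximal dissipative for $\lambda\in\mathbb C_+$ and maximal accumulative for $\lambda\in\mathbb C_-$; $\mathcal M(\lambda)^*=\mathcal M(\bar\lambda)$;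 and, for some $\mu\in\mathbb C_+$ (respectively $\mathbb C_-$), $(\mathcal M(\lambda)+\mu)^{-1}$ is an everywhere defined bounded operator depending holomorphically on $\lambda\in\mathbb C_+$ (respectively $\mathbb C_-$). A family of linear relations $\mathcal M(\lambda)$, $\lambda\in\mathbb C\setminus\mathbb R_+$, is a Stieltjes family (an inverse Stieltjes family) if its restriction to $\mathbb C\setminus\mathbb R$ is a Nevanlinna family, $\mathcal M(x)\ge 0$ ($\mathcal M(x)\le 0$) for all $x<0$, and, for some $\mu\in\mathbb C_+$ (respectively $\mathbb C_-$), the function $(\mathcal M(\lambda)+\mu)^{-1}$, $\lambda\in\mathbb C_+$ (respectively $\mathbb C_-$), has an analytic continuation to $(-\infty,0)$ whose value at $x<0$ is the everywhere defined bounded operator $(\mathcal M(x)+\mu)^{-1}$. Consider the transformations $\Phi_+(\mathcal Q)(\lambda)=-\lambda^{-1}\mathcal Q(\lambda)^{-1}$ and $\Phi_-(\mathcal R)(\lambda)=-\lambda\,\mathcal R(\lambda)^{-1}$ of families of linear relations on $\mathbb C\setminus\mathbb R_+$, and let $\sqrt\lambda$, $\lambda\in\mathbb C\setminus\mathbb R_+$,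 be the branch of the square root with $\operatorname{Im}\sqrt\lambda>0$. Then: 1. There is exactly one Stieltjes family $\mathcal Q$ in $\mathfrak M$ with $\Phi_+(\mathcal Q)=\mathcal Q$, namely $\mathcal Q_0(\lambda)=\dfrac{i}{\sqrt\lambda}\,I_{\mathfrak M}$, and $\mathcal Q_0(-1)=I_{\mathfrak M}$. 2. There is exactly one inverse Stieltjes family $\mathcal R$ in $\mathfrak M$ with $\Phi_-(\mathcal R)=\mathcal R$, namely $\mathcal R_0(\lambda)=i\sqrt\lambda\,I_{\mathfrak M}$, and $\mathcal R_0(-1)=-I_{\mathfrak M}$. -/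

import Mathlib

namespace StieltjesFamilies

/-- Linear relations in `M`: linear subspaces of `M × M`, whose elements `(f, f')` are written
`{f, f'}` in the literature. An operator is identified with its graph. -/
abbrev LinRel (M : Type*) [NormedAddCommGroup M] [InnerProductSpace ℂ M] : Type _ :=
  Submodule ℂ (M × M)

namespace LinRel

variable {M : Type*} [NormedAddCommGroup M] [InnerProductSpace ℂ M]

/-- `T⁻¹ = {(f', f) : (f, f') ∈ T}`. -/
def inv (T : LinRel M) : LinRel M where
  carrier := {p | (p.2, p.1) ∈ T}
  add_mem' ha hb := T.add_mem ha hb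
  zero_mem' := T.zero_mem
  smul_mem' c _ hx := T.smul_mem c hx

/-- `c T = {(f, c f') : (f, f') ∈ T}`. -/
def scale (c : ℂ) (T : LinRel M) : LinRel M :=
  T.map (LinearMap.prodMap LinearMap.id (c • LinearMap.id))

/-- `T + c I = {(f, f' + c f) : (f, f') ∈ T}`. -/
def shift (T : LinRel M) (c : ℂ) : LinRel M :=
  T.map (LinearMap.prod (LinearMap.fst ℂ M M) (LinearMap.snd ℂ M M + c • LinearMap.fst ℂ M M))

/-- The graph of the everywhere defined bounded operator `A`. -/
def ofBounded (A : M →L[ℂ] M) : LinRel M := LinearMap.graph (A : M →ₗ[ℂ] M)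

/-- `Im (f', f) ≥ 0` on `T`. Mathlib's inner product is linear in the second argument, so
`(f', f)` is `inner ℂ f f'`. -/
def IsDissipative (T : LinRel M) : Prop := ∀ p ∈ T, 0 ≤ (inner ℂ p.1 p.2).im

/-- `Im (f', f) ≤ 0` on `T`. -/
def IsAccumulative (T : LinRel M) : Prop := ∀ p ∈ T, (inner ℂ p.1 p.2).im ≤ 0

/-- `(f', f)` is real and nonnegative on `T`. -/
def IsNonneg (T : LinRel M) : Prop :=
  ∀ p ∈ T, (inner ℂ p.1 p.2).im = 0 ∧ 0 ≤ (inner ℂ p.1 p.2).re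

/-- `(f', f)` is real and nonpositive on `T`. -/
def IsNonpos (T : LinRel M) : Prop :=
  ∀ p ∈ T, (inner ℂ p.1 p.2).im = 0 ∧ (inner ℂ p.1 p.2).re ≤ 0

end LinRel

/-- The domain `ℂ \ ℝ`. -/
def nonrealPlane : Set ℂ := {z | z.im ≠ 0}

/-- The domain `ℂ \ ℝ₊`, where `ℝ₊ = [0, ∞)`. -/
def cutPlane : Set ℂ := {z | z.im ≠ 0 ∨ z.re < 0}

theorem nonrealPlane_subset_cutPlane : nonrealPlane ⊆ cutPlane := fun _ h => Or.inl h

theorem conj_mem_nonrealPlane {z : ℂ} (hz : z ∈ nonrealPlane) :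
    (starRingEnd ℂ) z ∈ nonrealPlane := by
  simpa [nonrealPlane] using hz

theorem neg_one_mem_cutPlane : (-1 : ℂ) ∈ cutPlane := by
  simp [cutPlane]

section Families

variable {M : Type*} [NormedAddCommGroup M] [InnerProductSpace ℂ M]

/-- `(T(z) + μ)⁻¹` is an everywhere defined bounded operator for all `z ∈ S` in the domain of
the family `T`, and `z ↦ (T(z) + μ)⁻¹`, `z ∈ S`, is the restriction of an operator function that
is holomorphic on an open neighbourhood of `S`. For open `S` this says that it is holomorphic
on `S`. -/
def HasHolomorphicResolventOn {D : Set ℂ} (T : D → LinRel M) (μ : ℂ) (S : Set ℂ) : Prop :=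
  ∃ (U : Set ℂ) (F : ℂ → M →L[ℂ] M), IsOpen U ∧ S ⊆ U ∧ DifferentiableOn ℂ F U ∧
    ∀ z : D, (z : ℂ) ∈ S → ((T z).shift μ).inv = LinRel.ofBounded (F z)

/-- Nevanlinna families of linear relations in `M`. -/
structure IsNevanlinnaFamily (T : nonrealPlane → LinRel M) : Prop where
  maximal_dissipative : ∀ z : nonrealPlane, 0 < (z : ℂ).im → Maximal LinRel.IsDissipative (T z)
  maximal_accumulative : ∀ z : nonrealPlane, (z : ℂ).im < 0 → Maximal LinRel.IsAccumulative (T z)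
  adjoint_eq : ∀ z : nonrealPlane,
    (T z).adjoint = T ⟨(starRingEnd ℂ) (z : ℂ), conj_mem_nonrealPlane z.2⟩
  holomorphic_upper : ∃ μ : ℂ, 0 < μ.im ∧ HasHolomorphicResolventOn T μ {z | 0 < z.im}
  holomorphic_lower : ∃ μ : ℂ, μ.im < 0 ∧ HasHolomorphicResolventOn T μ {z | z.im < 0}

/-- The restriction to `ℂ \ ℝ` of a family on `ℂ \ ℝ₊`. -/
def restrictNonreal (T : cutPlane → LinRel M) : nonrealPlane → LinRel M :=
  fun z => T ⟨z, nonrealPlane_subset_cutPlane z.2⟩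

/-- For some `μ ∈ ℂ₊` (respectively `ℂ₋`) the function `(T(z) + μ)⁻¹`, `z ∈ ℂ₊`
(respectively `ℂ₋`), continues analytically to `(-∞, 0)`, with the value `(T(x) + μ)⁻¹`
at `x < 0`. -/
def ContinuesToNegativeAxis (T : cutPlane → LinRel M) : Prop :=
  (∃ μ : ℂ, 0 < μ.im ∧ HasHolomorphicResolventOn T μ {z | z ∈ cutPlane ∧ 0 ≤ z.im}) ∧
  (∃ μ : ℂ, μ.im < 0 ∧ HasHolomorphicResolventOn T μ {z | z ∈ cutPlane ∧ z.im ≤ 0})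

/-- Stieltjes families of linear relations in `M`. -/
structure IsStieltjesFamily (T : cutPlane → LinRel M) : Prop where
  nevanlinna : IsNevanlinnaFamily (restrictNonreal T)
  nonneg : ∀ z : cutPlane, (z : ℂ).im = 0 → (T z).IsNonneg
  continuation : ContinuesToNegativeAxis T

/-- Inverse Stieltjes families of linear relations in `M`. -/
structure IsInverseStieltjesFamily (T : cutPlane → LinRel M) : Prop where
  nevanlinna : IsNevanlinnaFamily (restrictNonreal T)
  nonpos : ∀ z : cutPlane, (z : ℂ).im = 0 → (T z).IsNonpos
  continuation : ContinuesToNegativeAxis T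

/-- The transformation `Q(z) ↦ -Q(z)⁻¹ / z`. -/
noncomputable def phiPlus (Q : cutPlane → LinRel M) : cutPlane → LinRel M :=
  fun z => ((Q z).inv).scale (-(z : ℂ)⁻¹)

/-- The transformation `R(z) ↦ -z R(z)⁻¹`. -/
noncomputable def phiMinus (R : cutPlane → LinRel M) : cutPlane → LinRel M :=
  fun z => ((R z).inv).scale (-(z : ℂ))

end Families

/-- The branch of the square root on `ℂ \ ℝ₊` with positive imaginary part. -/
noncomputable def cutSqrt (z : ℂ) : ℂ := Complex.I * (-z) ^ (1 / 2 : ℂ)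

theorem cutSqrt_sq (z : ℂ) : cutSqrt z ^ 2 = z := by
  have h : ((-z) ^ (1 / 2 : ℂ)) ^ 2 = -z := by
    rw [← Complex.cpow_nat_mul]; norm_num
  rw [cutSqrt, mul_pow, h, Complex.I_sq]; ring

theorem cutSqrt_im_pos {z : ℂ} (hz : z ∈ cutPlane) : 0 < (cutSqrt z).im := by
  have hs : -z ∈ Complex.slitPlane := by
    rcases hz with h | h
    · exact Or.inr (by simpa using h)
    · exact Or.inl (by simpa using h)
  have h0 : -z ≠ 0 := Complex.slitPlane_ne_zero hs
  have harg : (-z).arg ≠ Real.pi := (Complex.mem_slitPlane_iff_arg.mp hs).1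
  have h1 := Complex.neg_pi_lt_arg (-z)
  have h2 := lt_of_le_of_ne (Complex.arg_le_pi (-z)) harg
  rw [cutSqrt, Complex.I_mul_im, Complex.cpow_def_of_ne_zero h0, Complex.exp_re]
  refine mul_pos (Real.exp_pos _) (Real.cos_pos_of_mem_Ioo ?_)
  have him : (Complex.log (-z) * (1 / 2 : ℂ)).im = (-z).arg / 2 := by
    rw [show (1 / 2 : ℂ) = ((1 / 2 : ℝ) : ℂ) by norm_num, Complex.im_mul_ofReal, Complex.log_im]
    ring
  rw [him]
  constructor <;> linarith

/-- `Q₀(z) = (i / √z) I`. -/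
noncomputable def Q0 (M : Type*) [NormedAddCommGroup M] [InnerProductSpace ℂ M] :
    cutPlane → LinRel M :=
  fun z => LinRel.ofBounded ((Complex.I / cutSqrt z) • ContinuousLinearMap.id ℂ M)

/-- `R₀(z) = i √z I`. -/
noncomputable def R0 (M : Type*) [NormedAddCommGroup M] [InnerProductSpace ℂ M] :
    cutPlane → LinRel M :=
  fun z => LinRel.ofBounded ((Complex.I * cutSqrt z) • ContinuousLinearMap.id ℂ M)

end StieltjesFamilies

/-!
If `T = a² T⁻¹`, then every `(f, f') ∈ T` comes with `(f', a² f) ∈ T`, hence with `(g, -a g) ∈ T`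
for `g = f' - a f`. So `T ⊆ a I` as soon as `-a` is not an eigenvalue of `T`.

For a fixed point of `Φ₊` or `Φ₋` take `a = i / √z` or `a = i √z`, a Nevanlinna function. For
nonreal `z`, the (maximal) dissipativity or accumulativity of `T` excludes the eigenvalue `-a` and
then turns the inclusion `T ⊆ a I` into an equality. For `z < 0`, the sign condition excludes the
eigenvalue, and equality holds because `T + μ` is onto.
-/

namespace StieltjesFamilies

open scoped ComplexConjugate

namespace LinRel

variable {M : Type*} [NormedAddCommGroup M] [InnerProductSpace ℂ M]

variable (M) in
/-- The relation `c I`, i.e. multiplication by `c`. -/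
noncomputable def scalar (c : ℂ) : LinRel M := ofBounded (c • ContinuousLinearMap.id ℂ M)

/-- `c` is an eigenvalue of the relation `T`: it contains `(g, c g)` for some `g ≠ 0`. -/
def HasEigenvalue (T : LinRel M) (c : ℂ) : Prop := ∃ g ≠ 0, (g, c • g) ∈ T

theorem mem_inv {T : LinRel M} {p : M × M} : p ∈ T.inv ↔ (p.2, p.1) ∈ T := Iff.rfl

theorem mem_shift {T : LinRel M} {c : ℂ} {p : M × M} :
    p ∈ T.shift c ↔ (p.1, p.2 - c • p.1) ∈ T := by
  constructor
  · rintro ⟨q, hq, rfl⟩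
    simpa using hq
  · exact fun h => ⟨_, h, by ext <;> simp⟩

theorem mem_scalar {c : ℂ} {p : M × M} : p ∈ scalar M c ↔ p.2 = c • p.1 := by
  simp [scalar, ofBounded, LinearMap.mem_graph_iff]

theorem mk_smul_mem_scalar (c : ℂ) (f : M) : (f, c • f) ∈ scalar M c := mem_scalar.mpr rfl

theorem scale_scalar (c d : ℂ) : (scalar M c).scale d = scalar M (d * c) := by
  ext p
  rw [mem_scalar, mul_smul]
  constructor
  · rintro ⟨q, hq, rfl⟩
    simp only [LinearMap.prodMap_apply, LinearMap.id_apply, LinearMap.smul_apply,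
      mem_scalar.mp hq]
  · exact fun h => ⟨_, mk_smul_mem_scalar c p.1, Prod.ext rfl h.symm⟩

theorem shift_scalar (c μ : ℂ) : (scalar M c).shift μ = scalar M (c + μ) := by
  ext p
  rw [mem_shift, mem_scalar, mem_scalar, sub_eq_iff_eq_add, add_smul]

theorem inv_scalar {c : ℂ} (hc : c ≠ 0) : (scalar M c).inv = scalar M c⁻¹ := by
  ext p
  rw [mem_inv, mem_scalar, mem_scalar, eq_inv_smul_iff₀ hc, eq_comm]

theorem adjoint_scalar (c : ℂ) : (scalar M c).adjoint = scalar M (conj c) := by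
  ext ⟨k, k'⟩
  rw [Submodule.mem_adjoint_iff, mem_scalar]
  constructor
  · intro h
    refine ext_inner_left ℂ fun f => ?_
    rw [inner_smul_right, ← inner_smul_left, eq_comm, ← sub_eq_zero]
    exact h f (c • f) (mk_smul_mem_scalar c f)
  · intro hk f f' hf
    rw [show f' = c • f from mem_scalar.mp hf, show k' = conj c • k from hk,
      inner_smul_left, inner_smul_right, sub_self]

theorem inner_eq_of_mem_scalar {c : ℂ} {p : M × M} (hp : p ∈ scalar M c) :
    inner ℂ p.1 p.2 = c * ((‖p.1‖ ^ 2 : ℝ) : ℂ) := by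
  rw [mem_scalar.mp hp, inner_smul_right, inner_self_eq_norm_sq_to_K]
  norm_cast

theorem isDissipative_scalar {c : ℂ} (hc : 0 ≤ c.im) : (scalar M c).IsDissipative := fun p hp => by
  rw [inner_eq_of_mem_scalar hp, Complex.im_mul_ofReal]
  positivity

theorem isAccumulative_scalar {c : ℂ} (hc : c.im ≤ 0) :
    (scalar M c).IsAccumulative := fun p hp => by
  rw [inner_eq_of_mem_scalar hp, Complex.im_mul_ofReal]
  exact mul_nonpos_of_nonpos_of_nonneg hc (sq_nonneg _)

theorem isNonneg_scalar {c : ℂ} (him : c.im = 0) (hre : 0 ≤ c.re) :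
    (scalar M c).IsNonneg := fun p hp => by
  rw [inner_eq_of_mem_scalar hp, Complex.im_mul_ofReal, Complex.re_mul_ofReal, him, zero_mul]
  exact ⟨rfl, by positivity⟩

theorem isNonpos_scalar {c : ℂ} (him : c.im = 0) (hre : c.re ≤ 0) :
    (scalar M c).IsNonpos := fun p hp => by
  rw [inner_eq_of_mem_scalar hp, Complex.im_mul_ofReal, Complex.re_mul_ofReal, him, zero_mul]
  exact ⟨rfl, mul_nonpos_of_nonpos_of_nonneg hre (sq_nonneg _)⟩

section Eigenvalues

variable {T : LinRel M} {c : ℂ}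

theorem HasEigenvalue.exists_pos_mul_eq_inner (h : T.HasEigenvalue c) :
    ∃ p ∈ T, ∃ r : ℝ, 0 < r ∧ inner ℂ p.1 p.2 = c * r := by
  obtain ⟨g, hg, hgT⟩ := h
  exact ⟨_, hgT, ‖g‖ ^ 2, by positivity, inner_eq_of_mem_scalar (mk_smul_mem_scalar c g)⟩

theorem IsDissipative.not_hasEigenvalue (hT : T.IsDissipative) (hc : c.im < 0) :
    ¬ T.HasEigenvalue c := fun h => by
  obtain ⟨p, hp, r, hr, hpr⟩ := h.exists_pos_mul_eq_inner
  have := hT p hp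
  rw [hpr, Complex.im_mul_ofReal] at this
  exact (mul_neg_of_neg_of_pos hc hr).not_ge this

theorem IsAccumulative.not_hasEigenvalue (hT : T.IsAccumulative) (hc : 0 < c.im) :
    ¬ T.HasEigenvalue c := fun h => by
  obtain ⟨p, hp, r, hr, hpr⟩ := h.exists_pos_mul_eq_inner
  have := hT p hp
  rw [hpr, Complex.im_mul_ofReal] at this
  exact (mul_pos hc hr).not_ge this

theorem IsNonneg.not_hasEigenvalue (hT : T.IsNonneg) (hc : c.re < 0) :
    ¬ T.HasEigenvalue c := fun h => by
  obtain ⟨p, hp, r, hr, hpr⟩ := h.exists_pos_mul_eq_inner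
  have := (hT p hp).2
  rw [hpr, Complex.re_mul_ofReal] at this
  exact (mul_neg_of_neg_of_pos hc hr).not_ge this

theorem IsNonpos.not_hasEigenvalue (hT : T.IsNonpos) (hc : 0 < c.re) :
    ¬ T.HasEigenvalue c := fun h => by
  obtain ⟨p, hp, r, hr, hpr⟩ := h.exists_pos_mul_eq_inner
  have := (hT p hp).2
  rw [hpr, Complex.re_mul_ofReal] at this
  exact (mul_pos hc hr).not_ge this

theorem le_scalar_of_mk_sub_mem {d : ℂ} (hd : ¬ T.HasEigenvalue d)
    (h : ∀ p ∈ T, (p.2 - c • p.1, d • (p.2 - c • p.1)) ∈ T) : T ≤ scalar M c := fun p hp =>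
  mem_scalar.mpr <| sub_eq_zero.mp <| not_not.mp fun hne => hd ⟨_, hne, h p hp⟩

/-- A proper extension of `c I` contains some `(0, g)` with `g ≠ 0`, which makes every complex
number an eigenvalue. -/
theorem le_scalar_of_scalar_le {d : ℂ} (h : scalar M c ≤ T) (hd : ¬ T.HasEigenvalue d) :
    T ≤ scalar M c := by
  refine le_scalar_of_mk_sub_mem hd fun p hp => ?_
  have hzero : (0, p.2 - c • p.1) ∈ T := by
    simpa [Prod.sub_def] using T.sub_mem hp (h (mk_smul_mem_scalar c p.1))
  convert T.add_mem (h (mk_smul_mem_scalar c (p.2 - c • p.1))) (T.smul_mem (d - c) hzero) using 1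
  simp only [Prod.smul_mk, Prod.mk_add_mk, smul_zero, add_zero, ← add_smul, add_sub_cancel]

theorem maximal_isDissipative_scalar (hc : 0 ≤ c.im) : Maximal IsDissipative (scalar M c) :=
  ⟨isDissipative_scalar hc, fun _ hT hle =>
    le_scalar_of_scalar_le hle (hT.not_hasEigenvalue (c := -Complex.I) (by simp))⟩

theorem maximal_isAccumulative_scalar (hc : c.im ≤ 0) : Maximal IsAccumulative (scalar M c) :=
  ⟨isAccumulative_scalar hc, fun _ hT hle =>
    le_scalar_of_scalar_le hle (hT.not_hasEigenvalue (c := Complex.I) (by simp))⟩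

theorem le_scalar_of_scale_inv_eq (hT : T.inv.scale (c ^ 2) = T) (hc : ¬ T.HasEigenvalue (-c)) :
    T ≤ scalar M c := by
  refine le_scalar_of_mk_sub_mem hc fun p hp => ?_
  have hswap : (p.2, c ^ 2 • p.1) ∈ T := hT ▸ ⟨(p.2, p.1), hp, by simp⟩
  convert T.sub_mem hswap (T.smul_mem c hp) using 1
  simp only [Prod.smul_def, Prod.mk_sub_mk, Prod.mk.injEq, true_and]
  module

theorem scale_inv_scalar (hc : c ≠ 0) : (scalar M c).inv.scale (c ^ 2) = scalar M c := by
  rw [inv_scalar hc, scale_scalar, pow_two, mul_inv_cancel_right₀ hc]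

theorem eq_scalar_of_le_of_inv_shift_eq {μ : ℂ} {F : M →L[ℂ] M} (hT : T ≤ scalar M c)
    (hF : (T.shift μ).inv = ofBounded F) : T = scalar M c := by
  refine hT.antisymm fun p hp => ?_
  have hmem : (F p.1, p.1 - μ • F p.1) ∈ T := by
    rw [← mem_shift (p := (F p.1, p.1)), ← mem_inv (p := (p.1, F p.1)), hF]
    rfl
  have hFp : p.1 - μ • F p.1 = c • F p.1 := mem_scalar.mp (hT hmem)
  have hp1 : (c + μ) • F p.1 = p.1 := by rw [add_smul, ← hFp, sub_add_cancel]
  have hp2 : (c + μ) • c • F p.1 = p.2 := by rw [smul_comm, hp1, mem_scalar.mp hp]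
  rw [hFp] at hmem
  simpa only [Prod.smul_mk, hp1, hp2] using T.smul_mem (c + μ) hmem

end Eigenvalues

end LinRel

theorem isOpen_cutPlane : IsOpen cutPlane :=
  (isOpen_ne_fun Complex.continuous_im continuous_const).union
    (isOpen_lt Complex.continuous_re continuous_const)

theorem conj_mem_cutPlane {z : ℂ} (hz : z ∈ cutPlane) : conj z ∈ cutPlane := by
  simpa [cutPlane] using hz

theorem neg_mem_slitPlane {z : ℂ} (hz : z ∈ cutPlane) : -z ∈ Complex.slitPlane :=
  hz.symm.imp (by simp) (by simp)

/-- Scalar Nevanlinna functions on `ℂ \ ℝ` that continue analytically across the negative axis.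
The strict inequality in `im_pos` only excludes the real constants. -/
structure IsScalarNevanlinna (c : ℂ → ℂ) : Prop where
  differentiableOn : DifferentiableOn ℂ c cutPlane
  map_conj : ∀ z ∈ cutPlane, c (conj z) = conj (c z)
  im_pos : ∀ z : ℂ, 0 < z.im → 0 < (c z).im

theorem hasHolomorphicResolventOn_scalar {M : Type*} [NormedAddCommGroup M]
    [InnerProductSpace ℂ M] {D U S : Set ℂ} {c : ℂ → ℂ} {μ : ℂ} (hU : IsOpen U)
    (hc : DifferentiableOn ℂ c U) (hSU : S ⊆ U) (hμ : ∀ z ∈ S, c z + μ ≠ 0) :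
    HasHolomorphicResolventOn (fun z : D => LinRel.scalar M (c z)) μ S := by
  have hcμ : DifferentiableOn ℂ (fun z => c z + μ) U := hc.add_const μ
  refine ⟨U ∩ (fun z => c z + μ) ⁻¹' {0}ᶜ, fun z => (c z + μ)⁻¹ • ContinuousLinearMap.id ℂ M,
    hcμ.continuousOn.isOpen_inter_preimage hU isOpen_compl_singleton,
    fun z hz => ⟨hSU hz, hμ z hz⟩,
    ((hcμ.mono Set.inter_subset_left).inv fun _ hz => hz.2).smul_const _, fun z hz => ?_⟩
  rw [LinRel.shift_scalar, LinRel.inv_scalar (hμ z hz), LinRel.scalar]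

namespace IsScalarNevanlinna

variable {c : ℂ → ℂ} (hc : IsScalarNevanlinna c)
include hc

theorem neg_inv (h0 : ∀ z ∈ cutPlane, c z ≠ 0) : IsScalarNevanlinna fun z => -(c z)⁻¹ where
  differentiableOn := (hc.differentiableOn.inv h0).neg
  map_conj z hz := by rw [hc.map_conj z hz, map_neg, map_inv₀]
  im_pos z hz := by
    rw [Complex.neg_im, Complex.inv_im, neg_div, neg_neg]
    exact div_pos (hc.im_pos z hz) (Complex.normSq_pos.mpr (h0 z (Or.inl hz.ne')))

theorem im_neg {z : ℂ} (hz : z.im < 0) : (c z).im < 0 := by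
  have := hc.im_pos (conj z) (by simpa using hz)
  rwa [hc.map_conj z (Or.inl hz.ne), Complex.conj_im, neg_pos] at this

theorem im_eq_zero {z : ℂ} (hz : z ∈ cutPlane) (him : z.im = 0) : (c z).im = 0 := by
  rw [← Complex.conj_eq_iff_im, ← hc.map_conj z hz, Complex.conj_eq_iff_im.mpr him]

theorem im_nonneg {z : ℂ} (hz : z ∈ cutPlane) (him : 0 ≤ z.im) : 0 ≤ (c z).im :=
  him.eq_or_lt.elim (fun h => (hc.im_eq_zero hz h.symm).ge) fun h => (hc.im_pos z h).le

theorem im_nonpos {z : ℂ} (hz : z ∈ cutPlane) (him : z.im ≤ 0) : (c z).im ≤ 0 :=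
  him.eq_or_lt.elim (fun h => (hc.im_eq_zero hz h).le) fun h => (hc.im_neg h).le

variable {M : Type*} [NormedAddCommGroup M] [InnerProductSpace ℂ M]

theorem hasHolomorphicResolventOn_upper {D S : Set ℂ} (hS : ∀ z ∈ S, z ∈ cutPlane ∧ 0 ≤ z.im) :
    HasHolomorphicResolventOn (fun z : D => LinRel.scalar M (c z)) Complex.I S :=
  hasHolomorphicResolventOn_scalar isOpen_cutPlane hc.differentiableOn (fun z hz => (hS z hz).1)
    fun z hz h0 => by
      have him := congrArg Complex.im h0
      rw [Complex.add_im, Complex.I_im, Complex.zero_im] at him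
      linarith [hc.im_nonneg (hS z hz).1 (hS z hz).2]

theorem hasHolomorphicResolventOn_lower {D S : Set ℂ} (hS : ∀ z ∈ S, z ∈ cutPlane ∧ z.im ≤ 0) :
    HasHolomorphicResolventOn (fun z : D => LinRel.scalar M (c z)) (-Complex.I) S :=
  hasHolomorphicResolventOn_scalar isOpen_cutPlane hc.differentiableOn (fun z hz => (hS z hz).1)
    fun z hz h0 => by
      have him := congrArg Complex.im h0
      rw [Complex.add_im, Complex.neg_im, Complex.I_im, Complex.zero_im] at him
      linarith [hc.im_nonpos (hS z hz).1 (hS z hz).2]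

theorem isNevanlinnaFamily_scalar :
    IsNevanlinnaFamily fun z : nonrealPlane => LinRel.scalar M (c z) where
  maximal_dissipative z hz := LinRel.maximal_isDissipative_scalar (hc.im_pos z hz).le
  maximal_accumulative z hz := LinRel.maximal_isAccumulative_scalar (hc.im_neg hz).le
  adjoint_eq z := by
    rw [LinRel.adjoint_scalar, hc.map_conj z (nonrealPlane_subset_cutPlane z.2)]
  holomorphic_upper := ⟨Complex.I, by simp,
    hc.hasHolomorphicResolventOn_upper fun _ hz => ⟨Or.inl (ne_of_gt hz), le_of_lt hz⟩⟩
  holomorphic_lower := ⟨-Complex.I, by simp,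
    hc.hasHolomorphicResolventOn_lower fun _ hz => ⟨Or.inl (ne_of_lt hz), le_of_lt hz⟩⟩

theorem continuesToNegativeAxis_scalar :
    ContinuesToNegativeAxis fun z : cutPlane => LinRel.scalar M (c z) :=
  ⟨⟨Complex.I, by simp, hc.hasHolomorphicResolventOn_upper fun _ hz => hz⟩,
    ⟨-Complex.I, by simp, hc.hasHolomorphicResolventOn_lower fun _ hz => hz⟩⟩

theorem eq_scalar_of_scale_inv_eq {T : cutPlane → LinRel M}
    (hT : IsNevanlinnaFamily (restrictNonreal T)) (hcont : ContinuesToNegativeAxis T)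
    (hfix : ∀ z : cutPlane, (T z).inv.scale (c z ^ 2) = T z)
    (hneg : ∀ z : cutPlane, (z : ℂ).im = 0 → ¬ (T z).HasEigenvalue (-c z)) :
    T = fun z : cutPlane => LinRel.scalar M (c z) := by
  ext1 z
  rcases lt_trichotomy (z : ℂ).im 0 with him | him | him
  · have hmax : Maximal LinRel.IsAccumulative (T z) := hT.maximal_accumulative ⟨z, him.ne⟩ him
    have hcz := hc.im_neg him
    exact hmax.eq_of_le (LinRel.isAccumulative_scalar hcz.le) <|
      LinRel.le_scalar_of_scale_inv_eq (hfix z) (hmax.prop.not_hasEigenvalue (by simpa using hcz))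
  · obtain ⟨⟨μ, -, U, F, -, -, -, hF⟩, -⟩ := hcont
    exact LinRel.eq_scalar_of_le_of_inv_shift_eq
      (LinRel.le_scalar_of_scale_inv_eq (hfix z) (hneg z him)) (hF z ⟨z.2, him.ge⟩)
  · have hmax : Maximal LinRel.IsDissipative (T z) := hT.maximal_dissipative ⟨z, him.ne'⟩ him
    have hcz := hc.im_pos z him
    exact hmax.eq_of_le (LinRel.isDissipative_scalar hcz.le) <|
      LinRel.le_scalar_of_scale_inv_eq (hfix z) (hmax.prop.not_hasEigenvalue (by simpa using hcz))

end IsScalarNevanlinna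

theorem cutSqrt_ne_zero {z : ℂ} (hz : z ∈ cutPlane) : cutSqrt z ≠ 0 := fun h => by
  simpa [h] using cutSqrt_im_pos hz

theorem cutSqrt_neg_one : cutSqrt (-1) = Complex.I := by
  simp [cutSqrt]

theorem differentiableOn_cutSqrt : DifferentiableOn ℂ cutSqrt cutPlane := fun _ hz =>
  ((differentiableAt_id.neg.cpow_const (neg_mem_slitPlane hz)).const_mul
    Complex.I).differentiableWithinAt

theorem cutSqrt_conj {z : ℂ} (hz : z ∈ cutPlane) :
    cutSqrt (conj z) = -conj (cutSqrt z) := by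
  have harg := (Complex.mem_slitPlane_iff_arg.mp (neg_mem_slitPlane hz)).1
  rw [cutSqrt, cutSqrt, ← map_neg, Complex.conj_cpow _ _ harg]
  simp [map_ofNat]

theorem cutSqrt_re_pos {z : ℂ} (hz : 0 < z.im) : 0 < (cutSqrt z).re := by
  have hsqrt := cutSqrt_im_pos (Or.inl hz.ne' : z ∈ cutPlane)
  have him : z.im = (cutSqrt z).re * (2 * (cutSqrt z).im) := by
    conv_lhs => rw [← cutSqrt_sq z, pow_two, Complex.mul_im]
    ring
  exact pos_of_mul_pos_left (him ▸ hz) (by positivity)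

theorem isScalarNevanlinna_I_mul_cutSqrt :
    IsScalarNevanlinna fun z => Complex.I * cutSqrt z where
  differentiableOn := differentiableOn_cutSqrt.const_mul _
  map_conj z hz := by rw [cutSqrt_conj hz, map_mul, Complex.conj_I, mul_neg, neg_mul]
  im_pos z hz := by rw [Complex.I_mul_im]; exact cutSqrt_re_pos hz

theorem neg_inv_I_mul_cutSqrt (z : ℂ) : -(Complex.I * cutSqrt z)⁻¹ = Complex.I / cutSqrt z := by
  rw [mul_inv, Complex.inv_I, neg_mul, neg_neg, div_eq_mul_inv]

theorem isScalarNevanlinna_I_div_cutSqrt :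
    IsScalarNevanlinna fun z => Complex.I / cutSqrt z := by
  simpa only [neg_inv_I_mul_cutSqrt] using isScalarNevanlinna_I_mul_cutSqrt.neg_inv
    fun z hz => mul_ne_zero Complex.I_ne_zero (cutSqrt_ne_zero hz)

theorem I_mul_cutSqrt_re_neg {z : ℂ} (hz : z ∈ cutPlane) : (Complex.I * cutSqrt z).re < 0 := by
  simpa using cutSqrt_im_pos hz

theorem I_div_cutSqrt_re_pos {z : ℂ} (hz : z ∈ cutPlane) : 0 < (Complex.I / cutSqrt z).re := by
  rw [← neg_inv_I_mul_cutSqrt, Complex.neg_re, Complex.inv_re, neg_pos]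
  exact div_neg_of_neg_of_pos (I_mul_cutSqrt_re_neg hz)
    (Complex.normSq_pos.mpr (mul_ne_zero Complex.I_ne_zero (cutSqrt_ne_zero hz)))

theorem I_mul_cutSqrt_sq (z : ℂ) : (Complex.I * cutSqrt z) ^ 2 = -z := by
  rw [mul_pow, cutSqrt_sq, Complex.I_sq, neg_one_mul]

theorem I_div_cutSqrt_sq (z : ℂ) : (Complex.I / cutSqrt z) ^ 2 = -z⁻¹ := by
  rw [div_pow, cutSqrt_sq, Complex.I_sq, neg_div, one_div]

section FixedPoints

variable (M : Type*) [NormedAddCommGroup M] [InnerProductSpace ℂ M]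

theorem isStieltjesFamily_Q0 : IsStieltjesFamily (Q0 M) where
  nevanlinna := isScalarNevanlinna_I_div_cutSqrt.isNevanlinnaFamily_scalar
  nonneg z hz := LinRel.isNonneg_scalar (isScalarNevanlinna_I_div_cutSqrt.im_eq_zero z.2 hz)
    (I_div_cutSqrt_re_pos z.2).le
  continuation := isScalarNevanlinna_I_div_cutSqrt.continuesToNegativeAxis_scalar

theorem isInverseStieltjesFamily_R0 : IsInverseStieltjesFamily (R0 M) where
  nevanlinna := isScalarNevanlinna_I_mul_cutSqrt.isNevanlinnaFamily_scalar
  nonpos z hz := LinRel.isNonpos_scalar (isScalarNevanlinna_I_mul_cutSqrt.im_eq_zero z.2 hz)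
    (I_mul_cutSqrt_re_neg z.2).le
  continuation := isScalarNevanlinna_I_mul_cutSqrt.continuesToNegativeAxis_scalar

theorem isFixedPt_phiPlus_Q0 : Function.IsFixedPt phiPlus (Q0 M) := funext fun z => by
  rw [phiPlus, ← I_div_cutSqrt_sq]
  exact LinRel.scale_inv_scalar (div_ne_zero Complex.I_ne_zero (cutSqrt_ne_zero z.2))

theorem isFixedPt_phiMinus_R0 : Function.IsFixedPt phiMinus (R0 M) := funext fun z => by
  rw [phiMinus, ← I_mul_cutSqrt_sq]
  exact LinRel.scale_inv_scalar (mul_ne_zero Complex.I_ne_zero (cutSqrt_ne_zero z.2))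

variable {M}

theorem IsStieltjesFamily.eq_Q0 {Q : cutPlane → LinRel M} (hQ : IsStieltjesFamily Q)
    (hfix : Function.IsFixedPt phiPlus Q) : Q = Q0 M :=
  isScalarNevanlinna_I_div_cutSqrt.eq_scalar_of_scale_inv_eq hQ.nevanlinna hQ.continuation
    (fun z => by rw [I_div_cutSqrt_sq]; exact congrFun hfix z)
    fun z hz => (hQ.nonneg z hz).not_hasEigenvalue (neg_neg_of_pos (I_div_cutSqrt_re_pos z.2))

theorem IsInverseStieltjesFamily.eq_R0 {R : cutPlane → LinRel M}
    (hR : IsInverseStieltjesFamily R) (hfix : Function.IsFixedPt phiMinus R) : R = R0 M :=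
  isScalarNevanlinna_I_mul_cutSqrt.eq_scalar_of_scale_inv_eq hR.nevanlinna hR.continuation
    (fun z => by rw [I_mul_cutSqrt_sq]; exact congrFun hfix z)
    fun z hz => (hR.nonpos z hz).not_hasEigenvalue (neg_pos_of_neg (I_mul_cutSqrt_re_neg z.2))

end FixedPoints

end StieltjesFamilies

open StieltjesFamilies in
theorem proposition4p7_general (M : Type*) [NormedAddCommGroup M] [InnerProductSpace ℂ M] :
    ({Q : cutPlane → LinRel M | IsStieltjesFamily Q ∧ Function.IsFixedPt phiPlus Q} = {Q0 M} ∧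
      Q0 M ⟨-1, neg_one_mem_cutPlane⟩ = LinRel.ofBounded (ContinuousLinearMap.id ℂ M)) ∧
    ({R : cutPlane → LinRel M | IsInverseStieltjesFamily R ∧ Function.IsFixedPt phiMinus R} =
        {R0 M} ∧
      R0 M ⟨-1, neg_one_mem_cutPlane⟩ = LinRel.ofBounded (-ContinuousLinearMap.id ℂ M)) := by
  refine ⟨⟨?_, ?_⟩, ?_, ?_⟩
  · exact Set.eq_singleton_iff_unique_mem.mpr
      ⟨⟨isStieltjesFamily_Q0 M, isFixedPt_phiPlus_Q0 M⟩, fun _ hQ => hQ.1.eq_Q0 hQ.2⟩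
  · rw [Q0, cutSqrt_neg_one, div_self Complex.I_ne_zero, one_smul]
  · exact Set.eq_singleton_iff_unique_mem.mpr
      ⟨⟨isInverseStieltjesFamily_R0 M, isFixedPt_phiMinus_R0 M⟩, fun _ hR => hR.1.eq_R0 hR.2⟩
  · rw [R0, cutSqrt_neg_one, Complex.I_mul_I, neg_one_smul]

open StieltjesFamilies in
theorem proposition4p7 (M : Type*) [NormedAddCommGroup M] [InnerProductSpace ℂ M]
    [CompleteSpace M] :
    ({Q : cutPlane → LinRel M | IsStieltjesFamily Q ∧ Function.IsFixedPt phiPlus Q} = {Q0 M} ∧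
      Q0 M ⟨-1, neg_one_mem_cutPlane⟩ = LinRel.ofBounded (ContinuousLinearMap.id ℂ M)) ∧
    ({R : cutPlane → LinRel M | IsInverseStieltjesFamily R ∧ Function.IsFixedPt phiMinus R} =
        {R0 M} ∧
      R0 M ⟨-1, neg_one_mem_cutPlane⟩ = LinRel.ofBounded (-ContinuousLinearMap.id ℂ M)) :=
  proposition4p7_general M
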